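/- Let $0<\nu<1$. For real $\lambda>-1$ and complex $\mu,z$ let $W_{\lambda,\mu}(z)=\sum_{n\ge 0}\frac{z^n}{n!\,\Gamma(\lambda n+\mu)}$ be the Wright function (with $1/\Gamma=0$ at the poles of $\Gamma$), and put $F_\nu(z)=W_{-\nu,0}(-z)$ and $M_\nu(z)=W_{-\nu,1-\nu}(-z)$. Powers of complex numbers are principal values. (a) For every $r>0$, $$\frac1r F_\nu(r^{-\nu})=\frac{\nu}{r^{\nu+1}}M_\nu(r^{-\nu}),\qquad \frac1\nu F_\nu(r^{-\nu})=\frac{1}{r^{\nu}}M_\nu(r^{-\nu}).$$ (b) For every $s\in\mathbb C$ with $\operatorname{Re}s>0$, the following Laplace integrals converge absolutely and $$\int_0^\infty e^{-sr}\,\frac{\nu}{r^{\nu+1}}M_\nu(r^{-\nu})\,dr=e^{-s^\nu},\qquad \int_0^\infty e^{-sr}\,\frac{1}{r^{\nu}}M_\nu(r^{-\nu})\,dr=\frac{e^{-s^\nu}}{s^{1-\nu}}.$$ (c) Conversely, for every $c>0$ and $r>0$, the following Bromwich integrals converge absolutely and $$\frac1{2\pi i}\int_{c-i\infty}^{c+i\infty}e^{sr}e^{-s^\nu}\,ds=\frac{\nu}{r^{\nu+1}}M_\nu(r^{-\nu}),\qquad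 \frac1{2\pi i}\int_{c-i\infty}^{c+i\infty}e^{sr}\,\frac{e^{-s^\nu}}{s^{1-\nu}}\,ds=\frac{1}{r^{\nu}}M_\nu(r^{-\nu}).$$ -/

import Mathlib

/-- The Wright function `W_{lam, μ}(z) = ∑_{n ≥ 0} z ^ n / (n! Γ(lam n + μ))`, for `lam > -1`.
Here `1 / Γ` is the entire reciprocal Gamma function: Mathlib's `Complex.Gamma` takes the value `0`
at the poles of `Γ`, and hence so does its inverse. -/
noncomputable def wrightW (lam : ℝ) (μ : ℂ) (z : ℂ) : ℂ :=
  ∑' n : ℕ, z ^ n * ((n.factorial : ℂ) * Complex.Gamma ((lam : ℂ) * (n : ℂ) + μ))⁻¹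

/-- The auxiliary function `F_ν(z) = W_{-ν, 0}(-z)`. -/
noncomputable def auxF (ν : ℝ) (z : ℂ) : ℂ := wrightW (-ν) 0 (-z)

/-- The auxiliary function `M_ν(z) = W_{-ν, 1 - ν}(-z)` (the M-Wright function). -/
noncomputable def auxM (ν : ℝ) (z : ℂ) : ℂ := wrightW (-ν) (1 - (ν : ℂ)) (-z)

/-- `∫_0^∞ e^{-s r} f(r) dr` converges absolutely and equals `L`. -/
def HasLaplaceAt (f : ℝ → ℂ) (s L : ℂ) : Prop :=
  MeasureTheory.IntegrableOn (fun r : ℝ => Complex.exp (-s * (r : ℂ)) * f r) (Set.Ioi 0) ∧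
    ∫ r in Set.Ioi (0 : ℝ), Complex.exp (-s * (r : ℂ)) * f r = L

/-- The Bromwich integral `(1 / (2 π i)) ∫ e^{s r} g(s) ds` along the vertical line `Re s = c`,
parametrized upwards by `s = c + i y`, converges absolutely and equals `v`. -/
def HasBromwichAt (g : ℂ → ℂ) (c r : ℝ) (v : ℂ) : Prop :=
  MeasureTheory.Integrable (fun y : ℝ =>
      Complex.exp (((c : ℂ) + (y : ℂ) * Complex.I) * (r : ℂ)) *
        g ((c : ℂ) + (y : ℂ) * Complex.I) * Complex.I) ∧
    (1 / (2 * (Real.pi : ℂ) * Complex.I)) *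
      (∫ y : ℝ, Complex.exp (((c : ℂ) + (y : ℂ) * Complex.I) * (r : ℂ)) *
        g ((c : ℂ) + (y : ℂ) * Complex.I) * Complex.I) = v

open Complex Set Filter Topology MeasureTheory FourierTransform

/-! The bound `|e^{-s^ν}| ≤ exp(-cos(πν/2)|Im s|^ν)` on the closed right half plane makes every
Bromwich integral of `e^{-s^ν}` absolutely convergent, and Cauchy's theorem makes it independent of
`c`. Letting `c → 0` moves it to the imaginary axis. There each half line gives an integral of
`e^{-α t^ν} e^{-ρ t}` with `α = (±i)^ν` and `ρ = ∓ir`. Expanding `e^{-α t^ν}` and integrating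
termwise produces `Γ(νn+1)`; the two halves combine to a factor `sin(πνn)`, and the reflection
formula turns the product into `1/Γ(-νn)`. This is the series of `F_ν(r^{-ν})/r`
(`integral_imaginary_axis_eq_auxF`).

The identity `F_ν(z) = νz M_ν(z)` is an index shift with `Γ(x+1) = xΓ(x)`. The kernel
`e^{-s^ν}/s^{1-ν}` follows by integrating by parts on the line, since `ν s^{ν-1} e^{-s^ν}` is minus
the derivative of `e^{-s^ν}`; its original is `r/ν` times the first one. The Laplace transforms come
from Fourier inversion on a vertical line (`laplace_of_bromwich`). -/

/-! ### Laplace integrals of powers and of `e^{-α t^ν}` -/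

/-- The Laplace integral of a real power at a complex parameter in the right half plane. -/
theorem integral_rpow_mul_cexp_neg_mul_Ioi {a : ℝ} {ρ : ℂ} (ha : 0 < a) (hρ : 0 < ρ.re) :
    ∫ t in Ioi (0 : ℝ), ((t ^ (a - 1) : ℝ) : ℂ) * cexp (-(ρ * t)) = ρ ^ (-(a : ℂ)) * Gamma a := by
  -- As the moment generating function at `-ρ` of the measure with density `t^(a-1)`, the integral
  -- is holomorphic in `ρ`, so Euler's formula extends from positive reals by the identity theorem.
  set μ : Measure ℝ := (volume.restrict (Ioi (0 : ℝ))).withDensity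
    (fun t => ENNReal.ofReal (t ^ (a - 1))) with hμ
  have hmeas : Measurable fun t : ℝ => ENNReal.ofReal (t ^ (a - 1)) := by fun_prop
  have hint : ∀ z : ℂ, ProbabilityTheory.complexMGF id μ (-z) =
      ∫ t in Ioi (0 : ℝ), ((t ^ (a - 1) : ℝ) : ℂ) * cexp (-(z * t)) := by
    intro z
    rw [ProbabilityTheory.complexMGF, hμ, integral_withDensity_eq_integral_toReal_smul hmeas
      (by simp)]
    refine setIntegral_congr_fun measurableSet_Ioi fun t ht => ?_
    rw [ENNReal.toReal_ofReal (Real.rpow_nonneg (le_of_lt ht) _), real_smul, id, neg_mul]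
  have hset : Iio (0 : ℝ) ⊆ interior (ProbabilityTheory.integrableExpSet id μ) := by
    refine interior_maximal (fun x hx => ?_) isOpen_Iio
    rw [ProbabilityTheory.integrableExpSet, mem_ofPred_eq, hμ,
      integrable_withDensity_iff_integrable_smul' hmeas (by simp)]
    have h := integrableOn_rpow_mul_exp_neg_mul_rpow (p := 1) (s := a - 1) (b := -x)
      (by linarith) one_pos (neg_pos.2 hx)
    refine h.congr_fun (fun t ht => ?_) measurableSet_Ioi
    simp [ENNReal.toReal_ofReal (Real.rpow_nonneg (le_of_lt ht) _)]
  have hU : IsOpen {z : ℂ | 0 < z.re} := isOpen_lt continuous_const continuous_re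
  have hA : AnalyticOnNhd ℂ (fun z => ProbabilityTheory.complexMGF id μ (-z)) {z | 0 < z.re} := by
    refine DifferentiableOn.analyticOnNhd (fun z hz => ?_) hU
    have := (ProbabilityTheory.hasDerivAt_complexMGF (X := id) (μ := μ) (z := -z)
      (hset (by simpa using hz))).differentiableAt
    exact (this.comp z differentiableAt_id.neg).differentiableWithinAt
  have hB : AnalyticOnNhd ℂ (fun z : ℂ => z ^ (-(a : ℂ)) * Gamma a) {z | 0 < z.re} := by
    refine DifferentiableOn.analyticOnNhd (fun z hz => ?_) hU
    exact ((differentiableAt_id.cpow_const (Or.inl hz)).mul_const _).differentiableWithinAt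
  have hreal : ∀ x : ℝ, 0 < x → ProbabilityTheory.complexMGF id μ (-(x : ℂ)) =
      (x : ℂ) ^ (-(a : ℂ)) * Gamma a := by
    intro x hx
    rw [hint, cpow_neg, ← inv_cpow _ _ (by rw [arg_ofReal_of_nonneg hx.le]; exact Real.pi_pos.ne),
      ← one_div, ← integral_cpow_mul_exp_neg_mul_Ioi (by simpa using ha) hx]
    refine setIntegral_congr_fun measurableSet_Ioi fun t ht => ?_
    rw [ofReal_cpow (le_of_lt ht)]
    push_cast
    rfl
  have hfreq : ∃ᶠ z in 𝓝[≠] (1 : ℂ), ProbabilityTheory.complexMGF id μ (-z) =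
      z ^ (-(a : ℂ)) * Gamma a := by
    have ht : Tendsto (fun x : ℝ => (x : ℂ)) (𝓝[≠] 1) (𝓝[≠] (1 : ℂ)) := by
      refine tendsto_nhdsWithin_iff.2 ⟨?_, ?_⟩
      · simpa using (continuous_ofReal.tendsto 1).mono_left nhdsWithin_le_nhds
      · filter_upwards [self_mem_nhdsWithin] with x hx
        simpa using hx
    refine ht.frequently (Eventually.frequently ?_)
    filter_upwards [nhdsWithin_le_nhds (Ioi_mem_nhds (zero_lt_one' ℝ))] with x hx
    exact hreal x hx
  have := hA.eqOn_of_preconnected_of_frequently_eq hB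
    (convex_halfSpace_re_gt 0).isPreconnected (by simp) hfreq hρ
  rw [← hint]
  exact this

/-- A sublinear power in the exponent is dominated by exponential decay. -/
theorem integrableOn_exp_mul_rpow_mul_exp_neg_mul {ν A b : ℝ} (hν0 : 0 < ν) (hν1 : ν < 1)
    (hb : 0 < b) :
    IntegrableOn (fun t : ℝ => Real.exp (A * t ^ ν) * Real.exp (-(b * t))) (Ioi 0) := by
  refine integrable_of_isBigO_exp_neg (b := b / 2) (half_pos hb) ?_ ?_
  · refine Continuous.continuousOn ?_
    have := Real.continuous_rpow_const hν0.le
    fun_prop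
  · simp_rw [← Real.exp_add]
    rw [Real.isBigO_exp_comp_exp_comp]
    -- Multiply `A = o(t^(1-ν))` by `t^ν`.
    have h1 : (fun t : ℝ => A * t ^ ν) =o[atTop] fun t : ℝ => t := by
      have := ((Asymptotics.isLittleO_one_left_iff ℝ).2 ((tendsto_norm_atTop_atTop.comp
        (tendsto_rpow_atTop (sub_pos.2 hν1))))).const_mul_left A |>.mul_isBigO
        (Asymptotics.isBigO_refl (fun t : ℝ => t ^ ν) atTop)
      refine this.congr' (by filter_upwards with t; ring) ?_
      filter_upwards [eventually_gt_atTop 0] with t ht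
      rw [← Real.rpow_add ht, sub_add_cancel, Real.rpow_one]
    refine isBoundedUnder_of_eventually_le (a := 0) ?_
    filter_upwards [h1.bound (half_pos hb), eventually_ge_atTop 0] with t ht ht0
    have := le_trans (le_abs_self _) ht
    simp only [Real.norm_eq_abs, abs_of_nonneg ht0] at this
    simp only [Pi.sub_apply]
    linarith

/-- Termwise integration of the exponential series in `∫ e^{-ρ t} e^{-α t^ν} dt`. -/
theorem hasSum_integral_cexp_neg_mul_rpow {ν : ℝ} (hν0 : 0 < ν) (hν1 : ν < 1) (α : ℂ) {ρ : ℂ}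
    (hρ : 0 < ρ.re) :
    HasSum (fun n : ℕ => (-α) ^ n / (n.factorial : ℂ) *
        (ρ ^ (-((ν * n + 1 : ℝ) : ℂ)) * Gamma ((ν * n + 1 : ℝ) : ℂ)))
      (∫ t in Ioi (0 : ℝ), cexp (-α * ((t ^ ν : ℝ) : ℂ)) * cexp (-(ρ * t))) := by
  have hexp : ∀ x : ℝ, HasSum (fun n : ℕ => x ^ n / (n.factorial : ℝ)) (Real.exp x) := fun x => by
    rw [Real.exp_eq_exp_ℝ]; exact NormedSpace.expSeries_div_hasSum_exp x
  have hcexp : ∀ x : ℂ, HasSum (fun n : ℕ => x ^ n / (n.factorial : ℂ)) (cexp x) := fun x => by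
    rw [Complex.exp_eq_exp_ℂ]; exact NormedSpace.expSeries_div_hasSum_exp x
  have key := hasSum_integral_of_dominated_convergence (μ := volume.restrict (Ioi (0 : ℝ)))
    (F := fun (n : ℕ) (t : ℝ) => (-α * ((t ^ ν : ℝ) : ℂ)) ^ n / (n.factorial : ℂ) *
      cexp (-(ρ * t)))
    (f := fun t : ℝ => cexp (-α * ((t ^ ν : ℝ) : ℂ)) * cexp (-(ρ * t)))
    (fun (n : ℕ) (t : ℝ) => (‖α‖ * t ^ ν) ^ n / (n.factorial : ℝ) * Real.exp (-(ρ.re * t)))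
    (fun n => by
      refine Measurable.aestronglyMeasurable ?_
      fun_prop)
    (fun n => by
      refine (ae_restrict_iff' measurableSet_Ioi).2 (ae_of_all _ fun t ht => ?_)
      have : 0 ≤ t ^ ν := Real.rpow_nonneg (le_of_lt ht) _
      simp [Complex.norm_exp, abs_of_nonneg this])
    (ae_of_all _ fun t => ((hexp _).mul_right _).summable)
    (by
      have := integrableOn_exp_mul_rpow_mul_exp_neg_mul (A := ‖α‖) hν0 hν1 hρ
      refine this.congr (ae_of_all _ fun t => ?_)
      exact (((hexp _).mul_right _).tsum_eq).symm)
    (ae_of_all _ fun t => (hcexp _).mul_right _)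
  refine Eq.mp (congrArg (fun f => HasSum f _) (funext fun n => Eq.symm ?_)) key
  rw [← integral_rpow_mul_cexp_neg_mul_Ioi (by positivity) hρ, ← integral_const_mul]
  refine setIntegral_congr_fun measurableSet_Ioi fun t ht => ?_
  have : t ^ (ν * n + 1 - 1) = (t ^ ν) ^ n := by
    rw [add_sub_cancel_right, Real.rpow_mul (le_of_lt ht), Real.rpow_natCast]
  simp only [this, mul_pow]
  push_cast
  ring

/-- The termwise expansion at `α = -A`, `ρ = r`, read as a real series; it is the dominating series
for the passage to `Re ρ = 0`. -/
theorem summable_pow_div_factorial_mul_Gamma {ν : ℝ} (hν0 : 0 < ν) (hν1 : ν < 1) (A : ℝ)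
    {r : ℝ} (hr : 0 < r) :
    Summable fun n : ℕ => A ^ n / (n.factorial : ℝ) *
        (r ^ (-(ν * n + 1)) * Real.Gamma (ν * n + 1)) := by
  have h := (hasSum_integral_cexp_neg_mul_rpow hν0 hν1 (-A : ℂ) (ρ := r) (by simpa using hr)).summable
  rw [← Complex.summable_ofReal]
  refine h.congr fun n => ?_
  rw [neg_neg, Complex.Gamma_ofReal, ← ofReal_neg, ← ofReal_cpow hr.le]
  push_cast
  rfl

/-- `Re α > 0` allows the parameter `ρ` to reach the imaginary axis. -/
theorem hasSum_integral_cexp_neg_mul_rpow_of_re_nonneg {ν : ℝ} (hν0 : 0 < ν) (hν1 : ν < 1) {α ρ : ℂ}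
    (hα : 0 < α.re) (hρ : 0 ≤ ρ.re) (hρ0 : ρ ≠ 0) :
    HasSum (fun n : ℕ => (-α) ^ n / (n.factorial : ℂ) *
        (ρ ^ (-((ν * n + 1 : ℝ) : ℂ)) * Gamma ((ν * n + 1 : ℝ) : ℂ)))
      (∫ t in Ioi (0 : ℝ), cexp (-α * ((t ^ ν : ℝ) : ℂ)) * cexp (-(ρ * t))) := by
  have hr : 0 < ‖ρ‖ := norm_pos_iff.2 hρ0
  have hsum := summable_pow_div_factorial_mul_Gamma hν0 hν1 ‖α‖ hr
  have hG : ∀ n : ℕ, 0 < Real.Gamma (ν * n + 1) := fun n => Real.Gamma_pos_of_pos (by positivity)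
  -- Uniform in `‖z‖ ≥ ‖ρ‖`, hence valid for all `ρ + ε` with `ε > 0`: since `Re ρ ≥ 0`, the shift
  -- does not decrease the modulus.
  have hbound : ∀ z : ℂ, ‖ρ‖ ≤ ‖z‖ → ∀ n : ℕ, ‖(-α) ^ n / (n.factorial : ℂ) *
        (z ^ (-((ν * n + 1 : ℝ) : ℂ)) * Gamma ((ν * n + 1 : ℝ) : ℂ))‖ ≤
      ‖α‖ ^ n / (n.factorial : ℝ) * (‖ρ‖ ^ (-(ν * n + 1)) * Real.Gamma (ν * n + 1)) := by
    intro z hz n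
    have hp : (0 : ℝ) ≤ ν * n + 1 := by positivity
    rw [Complex.Gamma_ofReal, ← ofReal_neg, norm_mul, norm_mul, norm_cpow_real, norm_div, norm_pow,
      norm_neg, norm_natCast, norm_real, Real.norm_of_nonneg (hG n).le]
    refine mul_le_mul_of_nonneg_left (mul_le_mul_of_nonneg_right ?_ (hG n).le) (by positivity)
    exact Real.rpow_le_rpow_of_nonpos hr hz (neg_nonpos.2 hp)
  have hsumm : Summable (fun n : ℕ => (-α) ^ n / (n.factorial : ℂ) *
        (ρ ^ (-((ν * n + 1 : ℝ) : ℂ)) * Gamma ((ν * n + 1 : ℝ) : ℂ))) :=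
    Summable.of_norm_bounded hsum (hbound ρ le_rfl)
  have hlim : Tendsto (fun ε : ℝ => ρ + ε) (𝓝[>] 0) (𝓝 ρ) := by
    have : Tendsto (fun ε : ℝ => ρ + ε) (𝓝 0) (𝓝 (ρ + (0 : ℝ))) := by
      refine Continuous.tendsto ?_ _
      fun_prop
    simpa using this.mono_left nhdsWithin_le_nhds
  have hslit : ρ ∈ slitPlane := by
    rw [mem_slitPlane_iff]
    by_contra! h
    exact hρ0 (Complex.ext (le_antisymm h.1 hρ) h.2)
  have h1 : Tendsto (fun ε : ℝ => ∑' n : ℕ, (-α) ^ n / (n.factorial : ℂ) *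
        ((ρ + ε) ^ (-((ν * n + 1 : ℝ) : ℂ)) * Gamma ((ν * n + 1 : ℝ) : ℂ))) (𝓝[>] 0)
      (𝓝 (∑' n : ℕ, (-α) ^ n / (n.factorial : ℂ) *
        (ρ ^ (-((ν * n + 1 : ℝ) : ℂ)) * Gamma ((ν * n + 1 : ℝ) : ℂ)))) := by
    refine tendsto_tsum_of_dominated_convergence hsum (fun n => ?_) ?_
    · exact (((continuousAt_cpow_const hslit).tendsto.comp hlim).mul_const _).const_mul _
    · filter_upwards [self_mem_nhdsWithin] with ε hε
      refine hbound _ ?_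
      rw [← sq_le_sq₀ (norm_nonneg _) (norm_nonneg _), ← normSq_eq_norm_sq, ← normSq_eq_norm_sq,
        normSq_apply, normSq_apply]
      simp only [add_re, ofReal_re, add_im, ofReal_im, add_zero]
      have : 0 < ε := hε
      nlinarith
  have h2 : Tendsto (fun ε : ℝ =>
        ∫ t in Ioi (0 : ℝ), cexp (-α * ((t ^ ν : ℝ) : ℂ)) * cexp (-((ρ + ε) * t))) (𝓝[>] 0)
      (𝓝 (∫ t in Ioi (0 : ℝ), cexp (-α * ((t ^ ν : ℝ) : ℂ)) * cexp (-(ρ * t)))) := by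
    -- On the boundary `e^{-ρt}` need not decay; the dominating function is `e^{-Re α t^ν}`.
    have hi := integrableOn_rpow_mul_exp_neg_mul_rpow (s := 0) (by norm_num) hν0 hα
    simp only [Real.rpow_zero, one_mul] at hi
    refine tendsto_integral_filter_of_dominated_convergence _ (Eventually.of_forall fun ε => ?_) ?_
      hi (ae_of_all _ fun t => ?_)
    · exact Measurable.aestronglyMeasurable (by fun_prop)
    · filter_upwards [self_mem_nhdsWithin] with ε hε
      refine (ae_restrict_iff' measurableSet_Ioi).2 (ae_of_all _ fun t ht => ?_)
      have h0 : 0 ≤ (ρ.re + ε) * t := mul_nonneg (add_nonneg hρ (le_of_lt hε)) (le_of_lt ht)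
      rw [norm_mul, Complex.norm_exp, Complex.norm_exp]
      refine (mul_le_of_le_one_right (Real.exp_pos _).le (Real.exp_le_one_iff.2 ?_)).trans_eq ?_
      · simpa using h0
      · simp
    · exact ((continuous_exp.tendsto _).comp ((hlim.mul_const _).neg)).const_mul _
  have h3 : Tendsto (fun ε : ℝ => ∑' n : ℕ, (-α) ^ n / (n.factorial : ℂ) *
        ((ρ + ε) ^ (-((ν * n + 1 : ℝ) : ℂ)) * Gamma ((ν * n + 1 : ℝ) : ℂ))) (𝓝[>] 0)
      (𝓝 (∫ t in Ioi (0 : ℝ), cexp (-α * ((t ^ ν : ℝ) : ℂ)) * cexp (-(ρ * t)))) := by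
    refine h2.congr' ?_
    filter_upwards [self_mem_nhdsWithin] with ε hε
    refine (hasSum_integral_cexp_neg_mul_rpow hν0 hν1 α (ρ := ρ + ε) ?_).tsum_eq.symm
    simpa using add_pos_of_nonneg_of_pos hρ hε
  rw [← tendsto_nhds_unique h1 h3]
  exact hsumm.hasSum

/-! ### Decay of `e^{-s^ν}` and shifting the vertical line -/

/-- `Re s^ν = |s|^ν cos(ν arg s)` with `|arg s| ≤ π/2`, and `|s| ≥ |Im s|`. The bound does not
involve `Re s`, so it serves both limits `c → 0` and `c → ∞`. -/
theorem norm_cexp_neg_cpow_le {ν : ℝ} (hν0 : 0 < ν) (hν1 : ν < 1) {s : ℂ} (hs : 0 ≤ s.re) :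
    ‖cexp (-(s ^ (ν : ℂ)))‖ ≤ Real.exp (-Real.cos (Real.pi / 2 * ν) * |s.im| ^ ν) := by
  have hπ := Real.pi_pos
  rw [Complex.norm_exp, Real.exp_le_exp, neg_re, cpow_ofReal_re, neg_mul, neg_le_neg_iff]
  have h1 : |s.im| ^ ν ≤ ‖s‖ ^ ν := Real.rpow_le_rpow (abs_nonneg _) (abs_im_le_norm s) hν0.le
  have h2 : Real.cos (Real.pi / 2 * ν) ≤ Real.cos (arg s * ν) := by
    rw [← Real.cos_abs (arg s * ν), abs_mul, abs_of_pos hν0]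
    refine Real.cos_le_cos_of_nonneg_of_le_pi (by positivity) (by nlinarith) ?_
    exact mul_le_mul_of_nonneg_right (abs_arg_le_pi_div_two_iff.2 hs) hν0.le
  have h3 : 0 ≤ Real.cos (Real.pi / 2 * ν) :=
    Real.cos_nonneg_of_mem_Icc ⟨by nlinarith, by nlinarith⟩
  calc _ ≤ Real.cos (Real.pi / 2 * ν) * ‖s‖ ^ ν := mul_le_mul_of_nonneg_left h1 h3
    _ ≤ Real.cos (arg s * ν) * ‖s‖ ^ ν := mul_le_mul_of_nonneg_right h2 (by positivity)
    _ = _ := mul_comm _ _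

theorem cos_pi_div_two_mul_pos {ν : ℝ} (hν0 : 0 < ν) (hν1 : ν < 1) :
    0 < Real.cos (Real.pi / 2 * ν) := by
  have hπ := Real.pi_pos
  exact Real.cos_pos_of_mem_Ioo ⟨by nlinarith, by nlinarith⟩

theorem integrable_exp_neg_mul_abs_rpow {ν k : ℝ} (hν0 : 0 < ν) (hk : 0 < k) :
    Integrable fun y : ℝ => Real.exp (-k * |y| ^ ν) := by
  have hi := integrableOn_rpow_mul_exp_neg_mul_rpow (s := 0) (by norm_num) hν0 hk
  simp only [Real.rpow_zero, one_mul] at hi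
  have h1 : IntegrableOn (fun y : ℝ => Real.exp (-k * |y| ^ ν)) (Ioi 0) :=
    hi.congr_fun (fun y hy => by simp only [abs_of_pos (mem_Ioi.1 hy)]) measurableSet_Ioi
  have h2 : IntegrableOn (fun y : ℝ => Real.exp (-k * |y| ^ ν)) (Iio 0) := by
    have : IntegrableOn (fun y : ℝ => Real.exp (-k * |y| ^ ν)) (Ioi (-0)) := by simpa using h1
    simpa using this.comp_neg_Iio
  rw [← integrableOn_univ, ← Iio_union_Ici (a := (0 : ℝ)), integrableOn_union,
    integrableOn_Ici_iff_integrableOn_Ioi]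
  exact ⟨h2, h1⟩

theorem tendsto_exp_neg_mul_abs_rpow {ν k : ℝ} (hν0 : 0 < ν) (hk : 0 < k) {l : Filter ℝ}
    (hl : Tendsto (fun y : ℝ => |y|) l atTop) :
    Tendsto (fun y : ℝ => Real.exp (-k * |y| ^ ν)) l (𝓝 0) := by
  simp_rw [neg_mul]
  exact Real.tendsto_exp_neg_atTop_nhds_zero.comp
    (((tendsto_rpow_atTop hν0).comp hl).const_mul_atTop hk)

/-- Two vertical line integrals of a holomorphic function on the right half plane agree if the
function tends to zero uniformly in the strip between them. -/
theorem integral_vertical_eq_of_norm_le {H : ℂ → ℂ} {a b : ℝ} {B : ℝ → ℝ}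
    (hd : DifferentiableOn ℂ H {z | 0 < z.re}) (ha : 0 < a) (hb : 0 < b)
    (hia : Integrable fun y : ℝ => H (a + y * I)) (hib : Integrable fun y : ℝ => H (b + y * I))
    (hB : ∀ x ∈ uIcc a b, ∀ y : ℝ, ‖H (x + y * I)‖ ≤ B y)
    (hBtop : Tendsto B atTop (𝓝 0)) (hBbot : Tendsto B atBot (𝓝 0)) :
    ∫ y : ℝ, H (a + y * I) = ∫ y : ℝ, H (b + y * I) := by
  have hrect : ∀ T : ℝ, (∫ x : ℝ in a..b, H (x + (-T : ℝ) * I)) -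
      (∫ x : ℝ in a..b, H (x + T * I)) + I • (∫ y : ℝ in -T..T, H (b + y * I)) -
      I • (∫ y : ℝ in -T..T, H (a + y * I)) = 0 := by
    intro T
    have h := integral_boundary_rect_eq_zero_of_differentiableOn H (⟨a, -T⟩ : ℂ) (⟨b, T⟩ : ℂ)
      (hd.mono fun z hz => ?_)
    · simpa using h
    · exact lt_of_lt_of_le (lt_min ha hb) hz.1.1
  have hhor : ∀ l : Filter ℝ, Tendsto B l (𝓝 0) →
      Tendsto (fun T : ℝ => ∫ x : ℝ in a..b, H (x + T * I)) l (𝓝 0) := by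
    intro l hl
    refine squeeze_zero_norm (a := fun T => B T * |b - a|) (fun T => ?_) (by
      simpa using hl.mul_const |b - a|)
    exact intervalIntegral.norm_integral_le_of_norm_le_const fun x hx =>
      hB x (uIoc_subset_uIcc hx) T
  have h1 := (hhor _ hBbot).comp tendsto_neg_atTop_atBot
  have h2 := hhor _ hBtop
  have h3 := (intervalIntegral_tendsto_integral hib tendsto_neg_atTop_atBot tendsto_id).const_smul I
  have h4 := (intervalIntegral_tendsto_integral hia tendsto_neg_atTop_atBot tendsto_id).const_smul I
  have h5 := ((h1.sub h2).add h3).sub h4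
  have h6 := tendsto_nhds_unique h5 (tendsto_const_nhds.congr fun T => (hrect T).symm)
  have h7 : I * ∫ y : ℝ, H (a + y * I) = I * ∫ y : ℝ, H (b + y * I) := by
    simp only [sub_zero, zero_add, smul_eq_mul] at h6
    exact (sub_eq_zero.1 h6).symm
  exact mul_left_cancel₀ I_ne_zero h7

theorem norm_cexp_mul_cexp_neg_cpow_le {ν : ℝ} (hν0 : 0 < ν) (hν1 : ν < 1) {c : ℝ} (hc : 0 ≤ c)
    (r y : ℝ) :
    ‖cexp ((c + y * I) * r) * cexp (-((c + y * I) ^ (ν : ℂ)))‖ ≤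
      Real.exp (c * r) * Real.exp (-Real.cos (Real.pi / 2 * ν) * |y| ^ ν) := by
  rw [norm_mul]
  refine mul_le_mul ?_ ?_ (norm_nonneg _) (Real.exp_pos _).le
  · rw [Complex.norm_exp]; simp
  · simpa using norm_cexp_neg_cpow_le hν0 hν1 (s := c + y * I) (by simpa using hc)

theorem integrable_cexp_mul_cexp_neg_cpow {ν : ℝ} (hν0 : 0 < ν) (hν1 : ν < 1) {c : ℝ} (hc : 0 ≤ c)
    (r : ℝ) :
    Integrable fun y : ℝ => cexp ((c + y * I) * r) * cexp (-((c + y * I) ^ (ν : ℂ))) :=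
  ((integrable_exp_neg_mul_abs_rpow hν0 (cos_pi_div_two_mul_pos hν0 hν1)).const_mul _).mono'
    (Measurable.aestronglyMeasurable (by fun_prop))
    (ae_of_all _ fun y => norm_cexp_mul_cexp_neg_cpow_le hν0 hν1 hc r y)

theorem integral_cexp_mul_cexp_neg_cpow_eq {ν : ℝ} (hν0 : 0 < ν) (hν1 : ν < 1) {a b : ℝ}
    (ha : 0 < a) (hb : 0 < b) (r : ℝ) :
    ∫ y : ℝ, cexp ((a + y * I) * r) * cexp (-((a + y * I) ^ (ν : ℂ))) =
      ∫ y : ℝ, cexp ((b + y * I) * r) * cexp (-((b + y * I) ^ (ν : ℂ))) := by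
  have hk := cos_pi_div_two_mul_pos hν0 hν1
  refine integral_vertical_eq_of_norm_le (H := fun s => cexp (s * r) * cexp (-(s ^ (ν : ℂ))))
    (B := fun y => Real.exp ((a + b) * |r|) *
      Real.exp (-Real.cos (Real.pi / 2 * ν) * |y| ^ ν)) (fun s hs => ?_) ha hb
    (integrable_cexp_mul_cexp_neg_cpow hν0 hν1 ha.le r)
    (integrable_cexp_mul_cexp_neg_cpow hν0 hν1 hb.le r) (fun x hx y => ?_) ?_ ?_
  · have : DifferentiableAt ℂ (fun s : ℂ => s ^ (ν : ℂ)) s :=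
      differentiableAt_id.cpow_const (Or.inl hs)
    exact (((differentiableAt_id.mul_const _).cexp).mul this.neg.cexp).differentiableWithinAt
  · have hx0 : 0 ≤ x := (le_min ha.le hb.le).trans hx.1
    have hx1 : x ≤ a + b := hx.2.trans (max_le (by linarith) (by linarith))
    refine (norm_cexp_mul_cexp_neg_cpow_le hν0 hν1 hx0 r y).trans ?_
    refine mul_le_mul_of_nonneg_right (Real.exp_le_exp.2 ?_) (Real.exp_pos _).le
    exact (mul_le_mul_of_nonneg_left (le_abs_self r) hx0).trans
      (mul_le_mul_of_nonneg_right hx1 (abs_nonneg r))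
  · simpa using (tendsto_exp_neg_mul_abs_rpow hν0 hk tendsto_abs_atTop_atTop).const_mul
      (Real.exp ((a + b) * |r|))
  · simpa using (tendsto_exp_neg_mul_abs_rpow hν0 hk tendsto_abs_atBot_atTop).const_mul
      (Real.exp ((a + b) * |r|))

/-- The vertical line of integration can be pushed to the imaginary axis. -/
theorem integral_cexp_mul_cexp_neg_cpow_eq_imaginary_axis {ν : ℝ} (hν0 : 0 < ν) (hν1 : ν < 1)
    {c : ℝ} (hc : 0 < c) (r : ℝ) :
    ∫ y : ℝ, cexp ((c + y * I) * r) * cexp (-((c + y * I) ^ (ν : ℂ))) =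
      ∫ y : ℝ, cexp (y * I * r) * cexp (-((y * I) ^ (ν : ℂ))) := by
  have hk := cos_pi_div_two_mul_pos hν0 hν1
  have h1 : Tendsto (fun a : ℝ => ∫ y : ℝ, cexp ((a + y * I) * r) *
      cexp (-((a + y * I) ^ (ν : ℂ)))) (𝓝[>] 0)
      (𝓝 (∫ y : ℝ, cexp (y * I * r) * cexp (-((y * I) ^ (ν : ℂ))))) := by
    refine tendsto_integral_filter_of_dominated_convergence
      (fun y => Real.exp |r| * Real.exp (-Real.cos (Real.pi / 2 * ν) * |y| ^ ν))
      (Eventually.of_forall fun a => Measurable.aestronglyMeasurable (by fun_prop)) ?_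
      ((integrable_exp_neg_mul_abs_rpow hν0 hk).const_mul _) ?_
    · filter_upwards [Ioo_mem_nhdsGT (zero_lt_one' ℝ)] with a ha
      refine ae_of_all _ fun y => (norm_cexp_mul_cexp_neg_cpow_le hν0 hν1 ha.1.le r y).trans ?_
      gcongr
      exact (mul_le_mul_of_nonneg_left (le_abs_self r) ha.1.le).trans
        (mul_le_of_le_one_left (abs_nonneg r) ha.2.le)
    -- The null set `y = 0` is discarded because `y * I` is then the branch point of the power.
    · filter_upwards [compl_mem_ae_iff.2 (measure_singleton (0 : ℝ))] with y hy
      have hlim : Tendsto (fun a : ℝ => (a : ℂ) + y * I) (𝓝[>] 0) (𝓝 (y * I)) := by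
        have : Tendsto (fun a : ℝ => (a : ℂ) + y * I) (𝓝 0) (𝓝 ((0 : ℝ) + y * I)) :=
          Continuous.tendsto (by fun_prop) _
        simpa using this.mono_left nhdsWithin_le_nhds
      have hslit : (y : ℂ) * I ∈ slitPlane := Or.inr (by simpa using hy)
      exact ((continuous_exp.tendsto _).comp (hlim.mul_const _)).mul ((continuous_exp.tendsto _).comp
        (((continuousAt_cpow_const hslit).tendsto.comp hlim).neg))
  refine tendsto_nhds_unique (tendsto_const_nhds.congr' ?_) h1
  filter_upwards [self_mem_nhdsWithin] with a ha
  exact integral_cexp_mul_cexp_neg_cpow_eq hν0 hν1 hc ha r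

/-! ### The Wright series from the imaginary axis -/

theorem ofReal_pos_mul_cpow {t : ℝ} (ht : 0 < t) {x : ℂ} (hx : x ≠ 0) (w : ℂ) :
    ((t : ℂ) * x) ^ w = (t : ℂ) ^ w * x ^ w := by
  have ht' : (t : ℂ) ≠ 0 := ofReal_ne_zero.2 ht.ne'
  rw [cpow_def_of_ne_zero (mul_ne_zero ht' hx), cpow_def_of_ne_zero ht', cpow_def_of_ne_zero hx,
    log_ofReal_mul ht hx, ofReal_log ht.le, add_mul, Complex.exp_add]

theorem I_cpow_eq (w : ℂ) : I ^ w = cexp (Real.pi / 2 * I * w) := by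
  rw [cpow_def_of_ne_zero I_ne_zero, log_I]

theorem neg_I_cpow_eq (w : ℂ) : (-I) ^ w = cexp (-(Real.pi / 2) * I * w) := by
  rw [cpow_def_of_ne_zero (neg_ne_zero.2 I_ne_zero), log_neg_I]

/-- Euler's reflection formula. At integers `x` both sides vanish, as `Gamma` is `0` at its poles.
-/
theorem inv_Gamma_neg_eq (x : ℝ) (hx : 0 ≤ x) :
    (Gamma (-(x : ℂ)))⁻¹ = -(Gamma ((x + 1 : ℝ) : ℂ) * Complex.sin (Real.pi * x) / Real.pi) := by
  have hG : Gamma ((x + 1 : ℝ) : ℂ) ≠ 0 :=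
    Gamma_ne_zero_of_re_pos (by rw [ofReal_re]; linarith)
  have h := Complex.Gamma_mul_Gamma_one_sub (-(x : ℂ))
  rw [show (1 : ℂ) - -(x : ℂ) = ((x + 1 : ℝ) : ℂ) by push_cast; ring] at h
  rw [eq_div_of_mul_eq hG h, mul_neg, Complex.sin_neg, div_neg, neg_div, inv_neg, inv_div, div_eq_mul_inv,
    inv_div]
  ring

/-- The sum of the two half-line contributions to the `n`-th term. -/
theorem I_cpow_pow_mul_add (ν : ℝ) (n : ℕ) :
    (I ^ (ν : ℂ)) ^ n * (-I) ^ (-((ν * n + 1 : ℝ) : ℂ)) +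
      ((-I) ^ (ν : ℂ)) ^ n * I ^ (-((ν * n + 1 : ℝ) : ℂ)) =
      -2 * Complex.sin (Real.pi * ((ν * n : ℝ) : ℂ)) := by
  rw [I_cpow_eq, neg_I_cpow_eq, I_cpow_eq, neg_I_cpow_eq, ← Complex.exp_nat_mul,
    ← Complex.exp_nat_mul, ← Complex.exp_add, ← Complex.exp_add]
  rw [show -2 * Complex.sin (Real.pi * ((ν * n : ℝ) : ℂ)) =
    2 * Complex.cos (Real.pi * ((ν * n : ℝ) : ℂ) + Real.pi / 2) by
      rw [Complex.cos_add_pi_div_two]; ring, Complex.cos, mul_div_cancel₀ _ two_ne_zero]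
  congr 2 <;> push_cast <;> ring

/-- The Wright series arises from the integral along the imaginary axis. -/
theorem integral_imaginary_axis_eq_auxF {ν : ℝ} (hν0 : 0 < ν) (hν1 : ν < 1) {r : ℝ} (hr : 0 < r) :
    ∫ y : ℝ, cexp (y * I * r) * cexp (-((y * I) ^ (ν : ℂ))) =
      2 * Real.pi / r * auxF ν ((1 / r ^ ν : ℝ) : ℂ) := by
  have hr' : (r : ℂ) ≠ 0 := ofReal_ne_zero.2 hr.ne'
  have hk := cos_pi_div_two_mul_pos hν0 hν1
  -- Both rotated coefficients `(±I)^ν` have real part `cos(πν/2) > 0`, which is what the expansion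
  -- with purely imaginary `ρ` requires.
  have hIre : 0 < (I ^ (ν : ℂ)).re := by
    rw [cpow_ofReal_re, norm_I, arg_I, Real.one_rpow, one_mul]; exact hk
  have hnIre : 0 < ((-I) ^ (ν : ℂ)).re := by
    rw [cpow_ofReal_re, norm_neg, norm_I, arg_neg_I, Real.one_rpow, one_mul, neg_mul, Real.cos_neg]
    exact hk
  have hp := hasSum_integral_cexp_neg_mul_rpow_of_re_nonneg hν0 hν1 hIre (ρ := r * -I) (by simp)
    (mul_ne_zero hr' (neg_ne_zero.2 I_ne_zero))
  have hm := hasSum_integral_cexp_neg_mul_rpow_of_re_nonneg hν0 hν1 hnIre (ρ := r * I) (by simp)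
    (mul_ne_zero hr' I_ne_zero)
  have hint : Integrable fun y : ℝ => cexp (y * I * r) * cexp (-((y * I) ^ (ν : ℂ))) := by
    simpa using integrable_cexp_mul_cexp_neg_cpow hν0 hν1 le_rfl r
  have hsplit : ∫ y : ℝ, cexp (y * I * r) * cexp (-((y * I) ^ (ν : ℂ))) =
      (∫ t in Ioi (0 : ℝ), cexp (-(I ^ (ν : ℂ)) * ((t ^ ν : ℝ) : ℂ)) * cexp (-(r * -I * t))) +
      ∫ t in Ioi (0 : ℝ), cexp (-((-I) ^ (ν : ℂ)) * ((t ^ ν : ℝ) : ℂ)) * cexp (-(r * I * t)) := by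
    rw [← setIntegral_univ, ← Iic_union_Ioi (a := (0 : ℝ)), setIntegral_union (Iic_disjoint_Ioi le_rfl)
      measurableSet_Ioi hint.integrableOn hint.integrableOn, add_comm]
    congr 1
    · refine setIntegral_congr_fun measurableSet_Ioi fun t ht => ?_
      rw [ofReal_pos_mul_cpow ht I_ne_zero, ofReal_cpow (le_of_lt ht), mul_comm]
      congr 2 <;> ring
    · rw [← neg_zero, ← integral_comp_neg_Ioi, neg_zero]
      refine setIntegral_congr_fun measurableSet_Ioi fun t ht => ?_
      rw [ofReal_neg, neg_mul, ← mul_neg, ofReal_pos_mul_cpow ht (neg_ne_zero.2 I_ne_zero),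
        ofReal_cpow (le_of_lt ht), mul_comm]
      congr 2 <;> ring
  rw [hsplit, ← (hp.add hm).tsum_eq, auxF, wrightW, ← tsum_mul_left]
  refine tsum_congr fun n => ?_
  have hx : 0 ≤ ν * n := by positivity
  rw [ofReal_pos_mul_cpow hr (neg_ne_zero.2 I_ne_zero), ofReal_pos_mul_cpow hr I_ne_zero,
    mul_inv, add_zero, ofReal_neg, neg_mul, show (ν : ℂ) * n = ((ν * n : ℝ) : ℂ) by push_cast; rfl,
    inv_Gamma_neg_eq _ hx]
  have hpow : (r : ℂ) ^ (-((ν * n + 1 : ℝ) : ℂ)) = (((1 / r ^ ν : ℝ) : ℂ)) ^ n / r := by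
    rw [← ofReal_neg, ← ofReal_cpow hr.le, ← ofReal_pow, ← ofReal_div]
    congr 1
    rw [neg_add, Real.rpow_add hr, Real.rpow_neg_one, Real.rpow_neg hr.le, Real.rpow_mul hr.le,
      Real.rpow_natCast, one_div, inv_pow, div_eq_mul_inv]
  have hbr := I_cpow_pow_mul_add ν n
  have hπ : (Real.pi : ℂ) ≠ 0 := ofReal_ne_zero.2 Real.pi_pos.ne'
  rw [hpow, neg_pow (I ^ (ν : ℂ)), neg_pow ((-I) ^ (ν : ℂ)), neg_pow ((1 / r ^ ν : ℝ) : ℂ)]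
  generalize ((1 / r ^ ν : ℝ) : ℂ) ^ n = z at *
  generalize Gamma ((ν * n + 1 : ℝ) : ℂ) = G at *
  have hf : (n.factorial : ℂ) ≠ 0 := Nat.cast_ne_zero.2 n.factorial_ne_zero
  calc _ = (-1) ^ n / n.factorial * (z / r) * G * ((I ^ (ν : ℂ)) ^ n * (-I) ^ (-((ν * n + 1 : ℝ) : ℂ)) +
      ((-I) ^ (ν : ℂ)) ^ n * I ^ (-((ν * n + 1 : ℝ) : ℂ))) := by ring
    _ = _ := by
      rw [hbr]
      field_simp

/-- The term `n + 1` of `F_ν` is `νz` times the term `n` of `M_ν`, by `1/Γ(x) = x/Γ(x+1)` at `x =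
-ν(n+1)`; the term `n = 0` of `F_ν` vanishes because `1/Γ(0) = 0`. -/
theorem auxF_eq_mul_auxM (ν : ℝ) (z : ℂ) : auxF ν z = ν * z * auxM ν z := by
  have hterm : ∀ n : ℕ, (-z) ^ (n + 1) * (((n + 1).factorial : ℂ) *
      Gamma (((-ν : ℝ) : ℂ) * ((n + 1 : ℕ) : ℂ) + 0))⁻¹ = ν * z *
      ((-z) ^ n * ((n.factorial : ℂ) * Gamma (((-ν : ℝ) : ℂ) * (n : ℂ) + (1 - ν)))⁻¹) := by
    intro n
    have h := Complex.one_div_Gamma_eq_self_mul_one_div_Gamma_add_one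
      (((-ν : ℝ) : ℂ) * ((n + 1 : ℕ) : ℂ) + 0)
    have hn : (n : ℂ) + 1 ≠ 0 := Nat.cast_add_one_ne_zero n
    rw [mul_inv, mul_inv, h, show ((-ν : ℝ) : ℂ) * ((n + 1 : ℕ) : ℂ) + 0 + 1 =
      ((-ν : ℝ) : ℂ) * (n : ℂ) + (1 - ν) by push_cast; ring, Nat.factorial_succ]
    push_cast
    field_simp
    ring
  rw [auxF, auxM, wrightW, wrightW, ← tsum_mul_left]
  simp_rw [← hterm]
  refine (Function.Injective.tsum_eq Nat.succ_injective (f := fun n : ℕ => (-z) ^ n *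
    ((n.factorial : ℂ) * Gamma (((-ν : ℝ) : ℂ) * (n : ℂ) + 0))⁻¹) ?_).symm
  intro n hn
  rcases n with _ | n
  · simp at hn
  · exact ⟨n, rfl⟩

/-! ### Laplace transforms by Fourier inversion -/

/-- A function given by absolutely convergent Bromwich integrals of `g` along all vertical lines in
the right half plane has Laplace transform `g`. -/
theorem laplace_of_bromwich {g : ℂ → ℂ} {f : ℝ → ℂ} {C : ℝ}
    (hcont : ∀ c : ℝ, 0 < c → Continuous fun y : ℝ => g (c + y * I))
    (hint : ∀ c : ℝ, 0 < c → Integrable fun y : ℝ => g (c + y * I))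
    (hbd : ∀ c : ℝ, 1 ≤ c → ∫ y : ℝ, ‖g (c + y * I)‖ ≤ C)
    (hinv : ∀ c : ℝ, 0 < c → ∀ r : ℝ,
      ∫ y : ℝ, cexp ((c + y * I) * r) * g (c + y * I) = 2 * Real.pi * f r)
    {s : ℂ} (hs : 0 < s.re) :
    IntegrableOn (fun r : ℝ => cexp (-s * r) * f r) (Ioi 0) ∧
      ∫ r in Ioi (0 : ℝ), cexp (-s * r) * f r = g s := by
  have hπ := Real.pi_pos
  have hbound : ∀ c : ℝ, 0 < c → ∀ r : ℝ,
      2 * Real.pi * ‖f r‖ ≤ Real.exp (c * r) * ∫ y : ℝ, ‖g (c + y * I)‖ := by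
    intro c hc r
    have h := norm_integral_le_integral_norm (μ := volume)
      (fun y : ℝ => cexp ((c + y * I) * r) * g (c + y * I))
    rw [hinv c hc r] at h
    have h2 : ∀ y : ℝ, ‖cexp ((c + y * I) * r) * g (c + y * I)‖ =
        Real.exp (c * r) * ‖g (c + y * I)‖ := fun y => by
      rw [norm_mul, Complex.norm_exp]; simp
    simp_rw [h2, integral_const_mul] at h
    simpa [abs_of_pos hπ] using h
  -- Causality: let `c → ∞` in `hbound`; the integrals of `‖g‖` stay below `C` while `e^{cr} → 0`.
  have hneg : ∀ r : ℝ, r < 0 → f r = 0 := by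
    intro r hr
    have hlim : Tendsto (fun c : ℝ => Real.exp (c * r) * C) atTop (𝓝 0) := by
      simpa using (Real.tendsto_exp_atBot.comp
        (tendsto_id.atTop_mul_const_of_neg hr)).mul_const C
    have hle : 2 * Real.pi * ‖f r‖ ≤ 0 := by
      refine ge_of_tendsto hlim ?_
      filter_upwards [eventually_ge_atTop 1] with c hc
      exact (hbound c (by linarith) r).trans
        (mul_le_mul_of_nonneg_left (hbd c hc) (Real.exp_pos _).le)
    exact norm_le_zero_iff.1 (nonpos_of_mul_nonpos_right hle (by positivity))
  set c := s.re with hc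
  set φ : ℝ → ℂ := fun y => g (c + y * I) with hφ
  have hFinv : ∀ w : ℝ, 𝓕⁻ φ w = 2 * Real.pi *
      (cexp (-c * ((2 * Real.pi * w : ℝ) : ℂ)) * f (2 * Real.pi * w)) := by
    intro w
    rw [Real.fourierInv_eq']
    have h := hinv c hs (2 * Real.pi * w)
    rw [mul_left_comm, ← h, ← integral_const_mul]
    refine integral_congr_ae (ae_of_all _ fun y => ?_)
    simp only [smul_eq_mul, hφ]
    rw [← mul_assoc, ← Complex.exp_add]
    congr 2
    simp
    ring
  have hFcont : Continuous (𝓕⁻ φ) := by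
    rw [Real.fourierInv_eq_fourier_comp_neg]
    exact VectorFourier.fourierIntegral_continuous Real.continuous_fourierChar
      (by exact continuous_inner) (hint c hs).comp_neg
  have hG : ∀ r : ℝ, cexp (-c * r) * f r = (2 * Real.pi : ℂ)⁻¹ * 𝓕⁻ φ ((2 * Real.pi)⁻¹ * r) := by
    intro r
    have hr : 2 * Real.pi * ((2 * Real.pi)⁻¹ * r) = r := by field_simp
    rw [hFinv, hr, inv_mul_cancel_left₀]
    exact mul_ne_zero two_ne_zero (ofReal_ne_zero.2 hπ.ne')
  have hGcont : Continuous fun r : ℝ => cexp (-c * r) * f r := by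
    simp_rw [hG]
    fun_prop
  have hGint : Integrable fun r : ℝ => cexp (-c * r) * f r := by
    rw [← integrableOn_univ, ← Iio_union_Ici (a := (0 : ℝ)), integrableOn_union,
      integrableOn_Ici_iff_integrableOn_Ioi]
    constructor
    · refine integrableOn_zero.congr_fun (fun r hr => ?_) measurableSet_Iio
      simp [hneg r hr]
    -- The line at abscissa `c/2` gives `f = O(e^{cr/2})`, leaving `e^{-cr/2}` to spare.
    · have hc2 : 0 < c / 2 := half_pos hs
      have hexp : IntegrableOn (fun r : ℝ => Real.exp (-(c / 2) * r)) (Ioi 0) :=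
        exp_neg_integrableOn_Ioi 0 hc2
      refine Integrable.mono' (hexp.const_mul ((2 * Real.pi)⁻¹ *
        ∫ y : ℝ, ‖g ((c / 2 : ℝ) + y * I)‖)) hGcont.aestronglyMeasurable (ae_of_all _ fun r => ?_)
      have h := hbound (c / 2) hc2 r
      rw [norm_mul, Complex.norm_exp]
      have h1 : ‖f r‖ ≤ (2 * Real.pi)⁻¹ *
          (Real.exp (c / 2 * r) * ∫ y : ℝ, ‖g ((c / 2 : ℝ) + y * I)‖) := by
        rw [inv_mul_eq_div, le_div_iff₀ (by positivity), mul_comm]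
        exact h
      refine (mul_le_mul_of_nonneg_left h1 (Real.exp_pos _).le).trans_eq ?_
      have h2 : Real.exp (-(c / 2) * r) = Real.exp ((-c * r : ℂ).re) * Real.exp (c / 2 * r) := by
        rw [← Real.exp_add]
        congr 1
        simp
        ring
      rw [h2]
      ring
  have hK : ∀ r : ℝ, cexp (-s * r) * f r =
      cexp (-(s.im * r) * I) * (cexp (-c * r) * f r) := by
    intro r
    rw [← mul_assoc, ← Complex.exp_add]
    congr 2
    conv_lhs => rw [← re_add_im s]
    rw [← hc]
    ring
  have hKint : Integrable fun r : ℝ => cexp (-s * r) * f r := by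
    refine hGint.norm.mono' ?_ (ae_of_all _ fun r => ?_)
    · simp_rw [hK]
      exact Continuous.aestronglyMeasurable (by fun_prop)
    · rw [hK, norm_mul, Complex.norm_exp]
      simp
  refine ⟨hKint.integrableOn, ?_⟩
  have hFint : Integrable (𝓕⁻ φ) := by
    have := (hGint.comp_mul_left' (R := 2 * Real.pi) (by positivity)).const_mul (2 * Real.pi : ℂ)
    exact this.congr (ae_of_all _ fun w => (hFinv w).symm)
  -- With `Re s = c`, evaluating the inversion at frequency `Im s` returns `g s`; the factors `2π`
  -- come from the normalisation `e^{2πi yw}`.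
  have hfour : 𝓕 (𝓕⁻ φ) s.im = φ s.im := by
    refine (hint c hs).fourier_fourierInv_eq ?_ (hcont c hs).continuousAt
    simpa [Real.fourierInv_eq_fourier_neg] using hFint.comp_neg
  have hscale := Measure.integral_comp_mul_left (fun r : ℝ => cexp (-s * r) * f r) (2 * Real.pi)
  have hval : 𝓕 (𝓕⁻ φ) s.im = 2 * Real.pi *
      ∫ w : ℝ, cexp (-s * ((2 * Real.pi * w : ℝ) : ℂ)) * f (2 * Real.pi * w) := by
    rw [Real.fourier_real_eq_integral_exp_smul, ← integral_const_mul]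
    refine integral_congr_ae (ae_of_all _ fun w => ?_)
    simp only [smul_eq_mul]
    rw [hFinv, hK, mul_left_comm]
    congr 3
    push_cast
    ring
  have hs' : φ s.im = g s := by rw [hφ]; simp only [hc, re_add_im]
  rw [← hs', ← hfour, hval, hscale, ← integral_Ici_eq_integral_Ioi,
    setIntegral_eq_integral_of_forall_compl_eq_zero fun r hr => by
      rw [hneg r (not_le.1 hr), mul_zero],
    abs_of_pos (by positivity), real_smul, ← mul_assoc]
  push_cast
  rw [mul_inv_cancel₀ (mul_ne_zero two_ne_zero (ofReal_ne_zero.2 hπ.ne')), one_mul]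

/-! ### The kernel `e^{-s^ν}/s^{1-ν}` -/

/-- Integration by parts on a vertical line. -/
theorem integral_cexp_mul_cexp_neg_cpow_div {ν : ℝ} (hν0 : 0 < ν) (hν1 : ν < 1) {c : ℝ}
    (hc : 0 < c) (r : ℝ)
    (hint : Integrable fun y : ℝ => cexp ((c + y * I) * r) *
      (cexp (-((c + y * I) ^ (ν : ℂ))) / (c + y * I) ^ (1 - (ν : ℂ)))) :
    ∫ y : ℝ, cexp ((c + y * I) * r) *
        (cexp (-((c + y * I) ^ (ν : ℂ))) / (c + y * I) ^ (1 - (ν : ℂ))) =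
      r / ν * ∫ y : ℝ, cexp ((c + y * I) * r) * cexp (-((c + y * I) ^ (ν : ℂ))) := by
  have hν : (ν : ℂ) ≠ 0 := ofReal_ne_zero.2 hν0.ne'
  have h1 := integrable_cexp_mul_cexp_neg_cpow hν0 hν1 hc.le r
  have hderiv : ∀ y : ℝ, HasDerivAt
      (fun y : ℝ => cexp ((c + y * I) * r) * cexp (-((c + y * I) ^ (ν : ℂ))))
      (I * (r * (cexp ((c + y * I) * r) * cexp (-((c + y * I) ^ (ν : ℂ)))) -
        ν * (cexp ((c + y * I) * r) *
        (cexp (-((c + y * I) ^ (ν : ℂ))) / (c + y * I) ^ (1 - (ν : ℂ)))))) y := by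
    intro y
    have hs : (c : ℂ) + y * I ∈ slitPlane := Or.inl (by simpa using hc)
    have hl : HasDerivAt (fun y : ℝ => (c : ℂ) + y * I) I y := by
      simpa using ((hasDerivAt_id y).ofReal_comp.mul_const I).const_add (c : ℂ)
    have hd : HasDerivAt (fun s : ℂ => cexp (s * r) * cexp (-(s ^ (ν : ℂ)))) _ (c + y * I) :=
      (((hasDerivAt_id _).mul_const (r : ℂ)).cexp).mul
        (((hasDerivAt_id _).cpow_const (c := (ν : ℂ)) hs).neg.cexp)
    have hcomp := hd.comp y hl
    refine HasDerivAt.congr_deriv hcomp ?_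
    simp only [id, Pi.neg_apply]
    rw [← neg_sub (ν : ℂ) 1, cpow_neg, div_inv_eq_mul]
    ring
  have h0 := integral_eq_zero_of_hasDerivAt_of_integrable hderiv
    (((h1.const_mul _).sub (hint.const_mul _)).const_mul _) h1
  rw [integral_const_mul, integral_sub (h1.const_mul _) (hint.const_mul _), integral_const_mul,
    integral_const_mul] at h0
  have h2 := sub_eq_zero.1 ((mul_eq_zero.1 h0).resolve_left I_ne_zero)
  rw [div_mul_eq_mul_div, h2, mul_div_cancel_left₀ _ hν]

theorem continuous_vertical_cexp_neg_cpow (ν : ℝ) {c : ℝ} (hc : 0 < c) :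
    Continuous fun y : ℝ => cexp (-((c + y * I) ^ (ν : ℂ))) := by
  refine (Continuous.neg ?_).cexp
  exact Continuous.cpow (by fun_prop) continuous_const fun y => Or.inl (by simpa using hc)

theorem norm_cexp_neg_cpow_div_le {ν : ℝ} (hν1 : ν < 1) {c : ℝ} (hc : 0 < c) (y : ℝ) :
    ‖cexp (-((c + y * I) ^ (ν : ℂ))) / (c + y * I) ^ (1 - (ν : ℂ))‖ ≤
      ‖cexp (-((c + y * I) ^ (ν : ℂ)))‖ / c ^ (1 - ν) := by
  rw [norm_div, show (1 : ℂ) - ν = ((1 - ν : ℝ) : ℂ) by push_cast; rfl, norm_cpow_real]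
  refine div_le_div_of_nonneg_left (norm_nonneg _) (Real.rpow_pos_of_pos hc _)
    (Real.rpow_le_rpow hc.le ?_ (by linarith))
  have := (le_abs_self _).trans (abs_re_le_norm ((c : ℂ) + y * I))
  simpa using this

theorem continuous_vertical_cexp_neg_cpow_div (ν : ℝ) {c : ℝ} (hc : 0 < c) :
    Continuous fun y : ℝ => cexp (-((c + y * I) ^ (ν : ℂ))) / (c + y * I) ^ (1 - (ν : ℂ)) := by
  have hs : ∀ y : ℝ, (c : ℂ) + y * I ∈ slitPlane := fun y => Or.inl (by simpa using hc)
  refine (continuous_vertical_cexp_neg_cpow ν hc).div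
    (Continuous.cpow (by fun_prop) continuous_const hs) fun y => ?_
  rw [Ne, cpow_eq_zero_iff]
  exact fun h => slitPlane_ne_zero (hs y) h.1

theorem integrable_vertical_cexp_neg_cpow {ν : ℝ} (hν0 : 0 < ν) (hν1 : ν < 1) {c : ℝ}
    (hc : 0 < c) : Integrable fun y : ℝ => cexp (-((c + y * I) ^ (ν : ℂ))) := by
  simpa using integrable_cexp_mul_cexp_neg_cpow hν0 hν1 hc.le 0

theorem integrable_vertical_cexp_neg_cpow_div {ν : ℝ} (hν0 : 0 < ν) (hν1 : ν < 1) {c : ℝ}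
    (hc : 0 < c) :
    Integrable fun y : ℝ => cexp (-((c + y * I) ^ (ν : ℂ))) / (c + y * I) ^ (1 - (ν : ℂ)) :=
  ((integrable_vertical_cexp_neg_cpow hν0 hν1 hc).norm.div_const _).mono'
    (continuous_vertical_cexp_neg_cpow_div ν hc).aestronglyMeasurable
    (ae_of_all _ (norm_cexp_neg_cpow_div_le hν1 hc))

theorem integrable_cexp_mul_cexp_neg_cpow_div {ν : ℝ} (hν0 : 0 < ν) (hν1 : ν < 1) {c : ℝ}
    (hc : 0 < c) (r : ℝ) :
    Integrable fun y : ℝ => cexp ((c + y * I) * r) *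
      (cexp (-((c + y * I) ^ (ν : ℂ))) / (c + y * I) ^ (1 - (ν : ℂ))) :=
  ((integrable_vertical_cexp_neg_cpow_div hν0 hν1 hc).norm.const_mul (Real.exp (c * r))).mono'
    (Continuous.aestronglyMeasurable
      (Continuous.mul (by fun_prop) (continuous_vertical_cexp_neg_cpow_div ν hc)))
    (ae_of_all _ fun y => by rw [norm_mul, Complex.norm_exp]; simp)

theorem integral_norm_vertical_cexp_neg_cpow_le {ν : ℝ} (hν0 : 0 < ν) (hν1 : ν < 1) {c : ℝ}
    (hc : 0 < c) : ∫ y : ℝ, ‖cexp (-((c + y * I) ^ (ν : ℂ)))‖ ≤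
      ∫ y : ℝ, Real.exp (-Real.cos (Real.pi / 2 * ν) * |y| ^ ν) := by
  refine integral_mono (integrable_vertical_cexp_neg_cpow hν0 hν1 hc).norm
    (integrable_exp_neg_mul_abs_rpow hν0 (cos_pi_div_two_mul_pos hν0 hν1)) fun y => ?_
  simpa using norm_cexp_mul_cexp_neg_cpow_le hν0 hν1 hc.le 0 y

/-- For `c ≥ 1` the denominator satisfies `|s|^(1-ν) ≥ c^(1-ν) ≥ 1`, so the bound is uniform in `c`,
as the limit `c → ∞` requires. -/
theorem integral_norm_vertical_cexp_neg_cpow_div_le {ν : ℝ} (hν0 : 0 < ν) (hν1 : ν < 1) {c : ℝ}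
    (hc : 1 ≤ c) : ∫ y : ℝ, ‖cexp (-((c + y * I) ^ (ν : ℂ))) / (c + y * I) ^ (1 - (ν : ℂ))‖ ≤
      ∫ y : ℝ, Real.exp (-Real.cos (Real.pi / 2 * ν) * |y| ^ ν) := by
  have hc0 : 0 < c := by linarith
  refine (integral_mono (integrable_vertical_cexp_neg_cpow_div hν0 hν1 hc0).norm
    (integrable_vertical_cexp_neg_cpow hν0 hν1 hc0).norm fun y => ?_).trans
      (integral_norm_vertical_cexp_neg_cpow_le hν0 hν1 hc0)
  exact (norm_cexp_neg_cpow_div_le hν1 hc0 y).trans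
    (div_le_self (norm_nonneg _) (Real.one_le_rpow hc (by linarith)))

theorem hasBromwichAt_of_integral_eq {g : ℂ → ℂ} {c r : ℝ} {v : ℂ}
    (hint : Integrable fun y : ℝ => cexp ((c + y * I) * r) * g (c + y * I))
    (hv : ∫ y : ℝ, cexp ((c + y * I) * r) * g (c + y * I) = 2 * Real.pi * v) :
    HasBromwichAt g c r v := by
  have hπ : (Real.pi : ℂ) ≠ 0 := ofReal_ne_zero.2 Real.pi_pos.ne'
  refine ⟨hint.mul_const I, ?_⟩
  rw [integral_mul_const, hv]
  field_simp

/-! ### Assembly -/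

theorem mainTheorem4 (ν : ℝ) (hν0 : 0 < ν) (hν1 : ν < 1) :
    -- the two expressions of each original function agree
    (∀ r : ℝ, 0 < r →
      (1 / (r : ℂ)) * auxF ν ((1 / r ^ ν : ℝ) : ℂ) =
          ((ν / r ^ (ν + 1) : ℝ) : ℂ) * auxM ν ((1 / r ^ ν : ℝ) : ℂ) ∧
      (1 / (ν : ℂ)) * auxF ν ((1 / r ^ ν : ℝ) : ℂ) =
          ((1 / r ^ ν : ℝ) : ℂ) * auxM ν ((1 / r ^ ν : ℝ) : ℂ)) ∧
    -- their Laplace transforms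
    (∀ s : ℂ, 0 < s.re →
      HasLaplaceAt (fun r : ℝ => ((ν / r ^ (ν + 1) : ℝ) : ℂ) * auxM ν ((1 / r ^ ν : ℝ) : ℂ)) s
        (Complex.exp (-(s ^ (ν : ℂ)))) ∧
      HasLaplaceAt (fun r : ℝ => ((1 / r ^ ν : ℝ) : ℂ) * auxM ν ((1 / r ^ ν : ℝ) : ℂ)) s
        (Complex.exp (-(s ^ (ν : ℂ))) / s ^ (1 - (ν : ℂ)))) ∧
    -- inversion by the Bromwich integral
    (∀ c r : ℝ, 0 < c → 0 < r →
      HasBromwichAt (fun s : ℂ => Complex.exp (-(s ^ (ν : ℂ)))) c r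
        (((ν / r ^ (ν + 1) : ℝ) : ℂ) * auxM ν ((1 / r ^ ν : ℝ) : ℂ)) ∧
      HasBromwichAt (fun s : ℂ => Complex.exp (-(s ^ (ν : ℂ))) / s ^ (1 - (ν : ℂ))) c r
        (((1 / r ^ ν : ℝ) : ℂ) * auxM ν ((1 / r ^ ν : ℝ) : ℂ))) := by
  have hνc : (ν : ℂ) ≠ 0 := ofReal_ne_zero.2 hν0.ne'
  have hπ : (Real.pi : ℂ) ≠ 0 := ofReal_ne_zero.2 Real.pi_pos.ne'
  have hA1 : ∀ r : ℝ, 0 < r → (1 / (r : ℂ)) * auxF ν ((1 / r ^ ν : ℝ) : ℂ) =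
      ((ν / r ^ (ν + 1) : ℝ) : ℂ) * auxM ν ((1 / r ^ ν : ℝ) : ℂ) := by
    intro r hr
    have hr' : (r : ℂ) ≠ 0 := ofReal_ne_zero.2 hr.ne'
    have hrν : ((r ^ ν : ℝ) : ℂ) ≠ 0 := ofReal_ne_zero.2 (Real.rpow_pos_of_pos hr ν).ne'
    rw [auxF_eq_mul_auxM, Real.rpow_add hr, Real.rpow_one, ← mul_assoc]
    congr 1
    push_cast
    field_simp
  have hA2 : ∀ r : ℝ, (1 / (ν : ℂ)) * auxF ν ((1 / r ^ ν : ℝ) : ℂ) =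
      ((1 / r ^ ν : ℝ) : ℂ) * auxM ν ((1 / r ^ ν : ℝ) : ℂ) := by
    intro r
    rw [auxF_eq_mul_auxM, mul_assoc, one_div, inv_mul_cancel_left₀ hνc]
  -- The original is taken on all of `ℝ` as a line integral, since Fourier inversion also needs `r ≤
  -- 0`, where the Wright formula is not available.
  obtain ⟨f, hf⟩ : ∃ f : ℝ → ℂ, ∀ c : ℝ, 0 < c → ∀ r : ℝ,
      ∫ y : ℝ, cexp ((c + y * I) * r) * cexp (-((c + y * I) ^ (ν : ℂ))) = 2 * Real.pi * f r := by
    refine ⟨fun r => (2 * Real.pi : ℂ)⁻¹ *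
      ∫ y : ℝ, cexp (y * I * r) * cexp (-((y * I) ^ (ν : ℂ))), fun c hc r => ?_⟩
    rw [mul_inv_cancel_left₀ (mul_ne_zero two_ne_zero hπ)]
    exact integral_cexp_mul_cexp_neg_cpow_eq_imaginary_axis hν0 hν1 hc r
  have hf2 : ∀ c : ℝ, 0 < c → ∀ r : ℝ,
      ∫ y : ℝ, cexp ((c + y * I) * r) *
        (cexp (-((c + y * I) ^ (ν : ℂ))) / (c + y * I) ^ (1 - (ν : ℂ))) =
      2 * Real.pi * (r / ν * f r) := by
    intro c hc r
    rw [integral_cexp_mul_cexp_neg_cpow_div hν0 hν1 hc r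
      (integrable_cexp_mul_cexp_neg_cpow_div hν0 hν1 hc r), hf c hc r]
    ring
  have hfF : ∀ r : ℝ, 0 < r → f r = (1 / (r : ℂ)) * auxF ν ((1 / r ^ ν : ℝ) : ℂ) := by
    intro r hr
    have h := hf 1 one_pos r
    rw [integral_cexp_mul_cexp_neg_cpow_eq_imaginary_axis hν0 hν1 one_pos,
      integral_imaginary_axis_eq_auxF hν0 hν1 hr] at h
    refine mul_left_cancel₀ (mul_ne_zero two_ne_zero hπ) (h.symm.trans ?_)
    ring
  have hf1M : ∀ r : ℝ, 0 < r →
      f r = ((ν / r ^ (ν + 1) : ℝ) : ℂ) * auxM ν ((1 / r ^ ν : ℝ) : ℂ) :=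
    fun r hr => (hfF r hr).trans (hA1 r hr)
  have hf2M : ∀ r : ℝ, 0 < r →
      r / ν * f r = ((1 / r ^ ν : ℝ) : ℂ) * auxM ν ((1 / r ^ ν : ℝ) : ℂ) := by
    intro r hr
    have hr' : (r : ℂ) ≠ 0 := ofReal_ne_zero.2 hr.ne'
    rw [← hA2 r, hfF r hr]
    field_simp
  have hLap : ∀ {g : ℂ → ℂ} {h k : ℝ → ℂ} {s : ℂ}, (∀ r : ℝ, 0 < r → h r = k r) →
      (IntegrableOn (fun r : ℝ => cexp (-s * r) * h r) (Ioi 0) ∧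
        ∫ r in Ioi (0 : ℝ), cexp (-s * r) * h r = g s) → HasLaplaceAt k s (g s) := by
    intro g h k s hhk H
    have heq : EqOn (fun r : ℝ => cexp (-s * r) * h r) (fun r : ℝ => cexp (-s * r) * k r)
        (Ioi 0) := fun r hr => congrArg _ (hhk r hr)
    exact ⟨H.1.congr_fun heq measurableSet_Ioi,
      (setIntegral_congr_fun measurableSet_Ioi heq).symm.trans H.2⟩
  refine ⟨fun r hr => ⟨hA1 r hr, hA2 r⟩, fun s hs => ⟨?_, ?_⟩, fun c r hc hr => ⟨?_, ?_⟩⟩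
  · exact hLap (g := fun s => cexp (-(s ^ (ν : ℂ)))) hf1M
      (laplace_of_bromwich (g := fun s => cexp (-(s ^ (ν : ℂ))))
        (fun c hc => continuous_vertical_cexp_neg_cpow ν hc)
        (fun c hc => integrable_vertical_cexp_neg_cpow hν0 hν1 hc)
        (fun c hc => integral_norm_vertical_cexp_neg_cpow_le hν0 hν1 (by linarith)) hf hs)
  · exact hLap (g := fun s => cexp (-(s ^ (ν : ℂ))) / s ^ (1 - (ν : ℂ))) hf2M
      (laplace_of_bromwich (g := fun s => cexp (-(s ^ (ν : ℂ))) / s ^ (1 - (ν : ℂ)))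
        (f := fun r => r / ν * f r) (fun c hc => continuous_vertical_cexp_neg_cpow_div ν hc)
        (fun c hc => integrable_vertical_cexp_neg_cpow_div hν0 hν1 hc)
        (fun c hc => integral_norm_vertical_cexp_neg_cpow_div_le hν0 hν1 hc) hf2 hs)
  · rw [← hf1M r hr]
    exact hasBromwichAt_of_integral_eq (integrable_cexp_mul_cexp_neg_cpow hν0 hν1 hc.le r)
      (hf c hc r)
  · rw [← hf2M r hr]
    exact hasBromwichAt_of_integral_eq (integrable_cexp_mul_cexp_neg_cpow_div hν0 hν1 hc r)
      (hf2 c hc r)
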